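/- Let $R$ be a commutative ring and $n \ge 0$ an integer, and let $S = R[X_0,\dots,X_n]_{\mathbb Q} = \bigcup_{i \ge 1} R[X_0^{1/i},\dots,X_n^{1/i}]$ be the ring of polynomials in $X_0,\dots,X_n$ with non-negative rational exponents, graded by total degree, $S = \bigoplus_{d \in \mathbb Q_{\ge 0}} S_d$ (with $S_d = 0$ for $d < 0$). Let $X = \operatorname{Proj} S$ be the set of homogeneous prime ideals of $S$ that do not contain $S_+ = \bigoplus_{d>0} S_d$, with the Zariski topology. For $m \in \mathbb Q$ let $\mathcal O_X(m)$ be the sheaf on $X$ associated with the graded $S$-module $S(m)$, $S(m)_d = S_{m+d}$; that is, its sections over an open set $U$ are the functions $\mathfrak p \mapsto f(\mathfrak p) \in S_{\mathfrak p}$ on $U$ that are locally of the form $r/s$ with $s \in S_d$ and $r \in S_{m+d}$ for some $d \in \mathbb Q$. Then for every $m \in \mathbb Q$ the Čech cohomology of $\mathcal O_X(m)$ with respect to the standard cover of $X$ by the open sets $D_+(X_j) = \{\mathfrak p \in X : X_j \notin \mathfrak p\}$, $0 \le j \le n$, satisfies $$H^i(X, \mathcal O_X(m)) = 0 \qquad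 \text{for all } 0 < i < n.$$ -/

import Mathlib

open CategoryTheory TopologicalSpace Opposite

universe u

namespace RationalDegree

/-! ### Polynomials with rational degrees -/

/-- `R[X_σ]_ℚ`: finite `R`-linear combinations of monomials `∏ X_s ^ a_s` whose exponents `a_s` are
non-negative rational numbers (finitely many of them nonzero).  This is the union of the polynomial
rings `R[X_s ^ (1/i) : s ∈ σ]` over all positive integers `i`. -/
abbrev RatMvPolynomial (σ : Type) (R : Type u) [CommRing R] : Type u :=
  AddMonoidAlgebra R (σ →₀ ℚ≥0)

/-- The monomial `X_s ^ a`, for a non-negative rational number `a`. -/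
noncomputable def RatMvPolynomial.Xpow {σ : Type} (R : Type u) [CommRing R] (s : σ) (a : ℚ≥0) :
    RatMvPolynomial σ R :=
  AddMonoidAlgebra.single (Finsupp.single s a) 1

/-- The variable `X_s`. -/
noncomputable def RatMvPolynomial.X {σ : Type} (R : Type u) [CommRing R] (s : σ) :
    RatMvPolynomial σ R :=
  RatMvPolynomial.Xpow R s 1

/-- The total degree of the monomial with exponent vector `a`, i.e. the sum of its exponents,
as a rational number. -/
noncomputable def monomialDegree (σ : Type) : (σ →₀ ℚ≥0) →+ ℚ :=
  (NNRat.coeHom : ℚ≥0 →+* ℚ).toAddMonoidHom.comp Finsupp.degree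

/-- The homogeneous polynomials of degree `d`, together with `0`: those whose monomials all have
total degree `d`.  (It is `0` for `d < 0`.) -/
noncomputable abbrev ratHomogeneous (σ : Type) (R : Type u) [CommRing R] :
    ℚ → Submodule R (RatMvPolynomial σ R) :=
  AddMonoidAlgebra.gradeBy R (monomialDegree σ)

/-! ### `Proj` of a ring graded by rational degrees -/

section Proj

variable {R A : Type u} [CommRing R] [CommRing A] [Algebra R A]
variable (𝒜 : ℚ → Submodule R A) [GradedAlgebra 𝒜]

/-- The ideal `A₊` generated by the homogeneous elements of positive degree. -/
def irrelevantIdeal : Ideal A :=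
  Ideal.span {a | ∃ d : ℚ, 0 < d ∧ a ∈ 𝒜 d}

/-- The points of `Proj A`: homogeneous prime ideals that do not contain `A₊`. -/
@[ext]
structure RatProj where
  asIdeal : Ideal A
  isPrime : asIdeal.IsPrime
  isHomogeneous : asIdeal.IsHomogeneous 𝒜
  not_irrelevant_le : ¬ irrelevantIdeal 𝒜 ≤ asIdeal

attribute [instance] RatProj.isPrime

namespace RatProj

/-- The inclusion of `Proj A` in `Spec A`. -/
def toPrimeSpectrum (p : RatProj 𝒜) : PrimeSpectrum A := ⟨p.asIdeal, p.isPrime⟩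

/-- The Zariski topology: the closed sets are the sets `V₊(I)` of points containing `I`. -/
instance : TopologicalSpace (RatProj 𝒜) :=
  TopologicalSpace.induced (toPrimeSpectrum 𝒜) inferInstance

/-- `Proj A` as an object of the category of topological spaces. -/
abbrev top : TopCat.{u} := TopCat.of (RatProj 𝒜)

/-- The open set `D₊(f)` of the points `p` with `f ∉ p`. -/
def basicOpen (f : A) : Opens (top 𝒜) where
  carrier := {p | f ∉ p.asIdeal}
  is_open' := ⟨PrimeSpectrum.basicOpen f, (PrimeSpectrum.basicOpen f).isOpen, rfl⟩

/-! ### The twisting sheaves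

`𝒪(m)` is the sheaf associated with the graded module `A(m)`, where `A(m)_d = A_{m + d}`: its
sections over `U` are the functions that assign to each `p ∈ U` an element of the localization at
`p` and that are locally of the form `r / s` with `r ∈ A(m)_d` and `s ∈ A_d`.  The degree-zero part
of the homogeneous localization of `A(m)` at `p` embeds in `A_p`, hence values are taken in `A_p`. -/

/-- On all of `U` the function `f` is one fraction `r / s`, with `s` homogeneous of some degree `d`
and `r` homogeneous of degree `m + d`. -/
def IsFraction (m : ℚ) {U : Opens (top 𝒜)} (f : ∀ x : U, Localization.AtPrime x.1.asIdeal) :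
    Prop :=
  ∃ (d : ℚ) (r : 𝒜 (m + d)) (s : 𝒜 d) (hs : ∀ x : U, (s : A) ∉ x.1.asIdeal),
    ∀ x : U, f x = Localization.mk (r : A) ⟨(s : A), hs x⟩

/-- Being one fraction is stable under restriction. -/
def isFractionPrelocal (m : ℚ) :
    TopCat.PrelocalPredicate fun x : top 𝒜 => Localization.AtPrime x.asIdeal where
  pred f := IsFraction 𝒜 m f
  res := by
    rintro V U i f ⟨d, r, s, hs, w⟩
    exact ⟨d, r, s, fun x => hs ⟨x.1, i.le x.2⟩, fun x => w ⟨x.1, i.le x.2⟩⟩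

/-- Being locally a fraction of degree `m`. -/
def isLocallyFraction (m : ℚ) :
    TopCat.LocalPredicate fun x : top 𝒜 => Localization.AtPrime x.asIdeal :=
  (isFractionPrelocal 𝒜 m).sheafify

/-- The `R`-module of sections of `𝒪(m)` over `U`. -/
def sections (m : ℚ) (U : Opens (top 𝒜)) :
    Submodule R (∀ x : U, Localization.AtPrime x.1.asIdeal) where
  carrier := {f | (isLocallyFraction 𝒜 m).pred f}
  zero_mem' := fun x =>
    ⟨U, x.2, 𝟙 U, 0, 0, ⟨1, SetLike.GradedOne.one_mem⟩,
      fun y => (Ideal.ne_top_iff_one _).1 y.1.isPrime.ne_top,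
      fun y => (Localization.mk_zero _).symm⟩
  add_mem' := by
    intro a b ha hb x
    obtain ⟨V, hV, i, d, r, s, hs, w⟩ := ha x
    obtain ⟨V', hV', i', d', r', s', hs', w'⟩ := hb x
    refine ⟨V ⊓ V', ⟨hV, hV'⟩, homOfLE (inf_le_left.trans i.le), d + d',
      ⟨(s' : A) * r + (s : A) * r', ?_⟩,
      ⟨(s : A) * s', SetLike.mul_mem_graded s.2 s'.2⟩,
      fun y => y.1.asIdeal.primeCompl.mul_mem (hs ⟨y.1, y.2.1⟩) (hs' ⟨y.1, y.2.2⟩), ?_⟩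
    · refine add_mem ?_ ?_
      · have := SetLike.mul_mem_graded s'.2 r.2
        rwa [show d' + (m + d) = m + (d + d') by ring] at this
      · have := SetLike.mul_mem_graded s.2 r'.2
        rwa [show d + (m + d') = m + (d + d') by ring] at this
    · intro y
      have h1 := w ⟨y.1, y.2.1⟩
      have h2 := w' ⟨y.1, y.2.2⟩
      dsimp only at h1 h2
      refine (congrArg₂ (· + ·) h1 h2).trans ?_
      dsimp only
      rw [Localization.add_mk, add_comm]
      rfl
  smul_mem' := by
    intro c a ha x
    obtain ⟨V, hV, i, d, r, s, hs, w⟩ := ha x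
    refine ⟨V, hV, i, d, c • r, s, hs, fun y => ?_⟩
    refine (congrArg (c • ·) (w y)).trans ?_
    dsimp only
    rw [Localization.smul_mk]
    rfl

/-- The presheaf of `R`-modules underlying `𝒪(m)`, with the restriction of functions. -/
def twistingPresheaf (m : ℚ) : TopCat.Presheaf (ModuleCat.{u} R) (top 𝒜) where
  obj U := ModuleCat.of R (sections 𝒜 m U.unop)
  map i := ModuleCat.ofHom
    { toFun := fun f => ⟨fun x => f.1 ⟨x.1, i.unop.le x.2⟩,
          (isLocallyFraction 𝒜 m).res i.unop f.1 f.2⟩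
      map_add' := fun _ _ => rfl
      map_smul' := fun _ _ => rfl }

/-- The twisting sheaf `𝒪(m)` on `Proj A`, for a rational number `m`, as a sheaf of `R`-modules. -/
def twistingSheaf (m : ℚ) : TopCat.Sheaf (ModuleCat.{u} R) (top 𝒜) :=
  ⟨twistingPresheaf 𝒜 m,
    (TopCat.Presheaf.isSheaf_iff_isSheaf_comp (forget (ModuleCat.{u} R)) _).mpr
      (TopCat.Presheaf.isSheaf_of_iso
        (NatIso.ofComponents (fun _ => Iso.refl _) (by cat_disch) :
          TopCat.subpresheafToTypes (isLocallyFraction 𝒜 m).toPrelocalPredicate ≅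
            twistingPresheaf 𝒜 m ⋙ forget (ModuleCat.{u} R))
        (TopCat.subpresheafToTypes.isSheaf (isLocallyFraction 𝒜 m)))⟩

end RatProj

end Proj

/-! ### Čech cohomology -/

/-- The Čech cohomology `Ȟ^i` of a sheaf of `R`-modules for a family of open sets `U`: the
cohomology of the complex with `∏ F(U_{j₀} ∩ ⋯ ∩ U_{jₚ})`, over all `(j₀, …, jₚ)`, in degree `p`. -/
noncomputable def cechCohomology {R : Type u} [CommRing R] {X : TopCat.{u}} {ι : Type}
    (U : ι → Opens X) (F : TopCat.Sheaf (ModuleCat.{u} R) X) (i : ℕ) : ModuleCat.{u} R :=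
  ((cechComplexFunctor U).obj F.obj).homology i

/-! ### Rational-degree projective space -/

section ProjectiveSpace

variable (R : Type u) [CommRing R] (n : ℕ)

/-- `X = Proj R[X₀, …, Xₙ]_ℚ`. -/
noncomputable abbrev ratProjectiveSpace : TopCat.{u} :=
  RatProj.top (ratHomogeneous (Fin (n + 1)) R)

/-- The standard cover of `X = Proj R[X₀, …, Xₙ]_ℚ` by the open sets `D₊(X_j)`, `0 ≤ j ≤ n`. -/
noncomputable def standardCover (j : Fin (n + 1)) : Opens (ratProjectiveSpace R n) :=
  RatProj.basicOpen (ratHomogeneous (Fin (n + 1)) R) (RatMvPolynomial.X R j)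

/-- The standard cover is a cover. -/
theorem iSup_standardCover : ⨆ j, standardCover R n j = ⊤ := by
  refine top_unique fun p _ => ?_
  rw [Opens.mem_iSup]
  by_contra! h
  have hX : ∀ j, RatMvPolynomial.X R j ∈ p.asIdeal := fun j => not_not.1 (h j)
  refine p.not_irrelevant_le (Ideal.span_le.2 ?_)
  rintro a ⟨d, hd, ha⟩
  rw [← AddMonoidAlgebra.sum_coeff_single a]
  refine Ideal.sum_mem _ fun v hv => ?_
  have hdeg : monomialDegree _ v = d := ha v hv
  obtain ⟨j, hj⟩ : ∃ j, v j ≠ 0 := by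
    by_contra! h0
    have : v = 0 := Finsupp.ext h0
    rw [this, map_zero] at hdeg
    exact hd.ne hdeg
  have hpow : RatMvPolynomial.Xpow R j (v j) ∈ p.asIdeal := by
    obtain ⟨k, hk⟩ := exists_nat_gt (1 / v j)
    have hk1 : 1 ≤ k • v j := by
      rw [nsmul_eq_mul]
      exact ((div_lt_iff₀ (pos_iff_ne_zero.2 hj)).1 hk).le
    refine p.isPrime.mem_of_pow_mem k ?_
    have : RatMvPolynomial.Xpow R j (v j) ^ k =
        RatMvPolynomial.Xpow R j (k • v j - 1) * RatMvPolynomial.X R j := by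
      simp only [RatMvPolynomial.Xpow, RatMvPolynomial.X, AddMonoidAlgebra.single_pow,
        AddMonoidAlgebra.single_mul_single, one_pow, mul_one, ← Finsupp.single_add,
        tsub_add_cancel_of_le hk1, Finsupp.smul_single]
    rw [this]
    exact p.asIdeal.mul_mem_left _ (hX j)
  have : (AddMonoidAlgebra.single v (a.coeff v) : RatMvPolynomial (Fin (n + 1)) R) =
      AddMonoidAlgebra.single (v.erase j) (a.coeff v) * RatMvPolynomial.Xpow R j (v j) := by
    rw [RatMvPolynomial.Xpow, AddMonoidAlgebra.single_mul_single, mul_one,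
      Finsupp.erase_add_single]
  rw [this]
  exact p.asIdeal.mul_mem_left _ hpow

/-- The sheaf `𝒪_X(m)` on `X = Proj R[X₀, …, Xₙ]_ℚ`. -/
noncomputable def twistingSheafOnProjectiveSpace (m : ℚ) :
    TopCat.Sheaf (ModuleCat.{u} R) (ratProjectiveSpace R n) :=
  RatProj.twistingSheaf (ratHomogeneous (Fin (n + 1)) R) m

end ProjectiveSpace

end RationalDegree

/-!
The Čech complex of `𝒪(m)` for the standard cover is computed by Laurent polynomials with rational
exponents, on which it can be contracted monomial by monomial.

*Sections as Laurent polynomials.* Over `D₊(g)`, with `g` homogeneous in `A₊`, every section of `𝒪(m)`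
is a fraction `a / g ^ k` with `a` homogeneous of degree `m + k * deg g`
(`RatProj.exists_pow_mul_eq`).  This is the usual partition of unity argument; quasi-compactness enters
through the statement that an ideal contained in no point of `D₊(g)` contains a power of `g`
(`RatProj.exists_pow_mem_of_not_le`).  Let `J` be a nonempty set of variables.  For `g = ∏_{s ∈ J} X_s`,
a section of `𝒪(m)` over `⋂_{s ∈ J} D₊(X_s)` therefore has a Laurent expansion in the group algebra of
the rational exponent vectors.  The expansion determines the section and is determined by it; it is
compatible with restriction; and the expansions that occur are exactly the Laurent polynomials all of
whose exponent vectors `v` have total degree `m` and satisfy `v s ≥ 0` for `s ∉ J`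
(`exists_laurentExpansion`, `eq_zero_of_laurentExpansion_zero`, `eq_of_laurentExpansion`,
`of_mem_support_laurentExpansion`, `exists_section_of_laurent`).

*Contraction.* Fix an exponent vector `v`.  If `v s ≥ 0` for some `s`, then `X ^ v` is allowed for the
indices `(s, α₀, …, α_q)` exactly when it is allowed for `(α₀, …, α_q)`, so prepending `s` contracts the
part of the complex in multidegree `v`, in positive degrees.  If all `v s` are negative, then `X ^ v`
is allowed only when all `n + 1` variables are inverted, which does not happen for cochains of degree
less than `n`.  So cocycles in degrees strictly between `0` and `n` are coboundaries
(`exists_laurent_primitive`).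
-/

namespace RationalDegree

/-! ### Sections of the twisting sheaves over a basic open set -/

namespace RatProj

variable {R A : Type u} [CommRing R] [CommRing A] [Algebra R A]
variable (𝒜 : ℚ → Submodule R A) [GradedAlgebra 𝒜]

/-- The homogeneous Nullstellensatz in `Proj A`: an ideal not contained in any point of `D₊(g)`
contains a power of `g`.  A prime containing `I` and avoiding the powers of `g` is replaced by its
homogeneous core. -/
theorem exists_pow_mem_of_not_le {g : A} (hg' : g ∈ irrelevantIdeal 𝒜) {I : Ideal A} (hI : I.IsHomogeneous 𝒜)
    (h : ∀ p : RatProj 𝒜, g ∉ p.asIdeal → ¬ I ≤ p.asIdeal) : ∃ k : ℕ, g ^ k ∈ I := by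
  by_contra! hk
  obtain ⟨P, hP, hIP, hd⟩ := I.exists_le_prime_disjoint (Submonoid.powers g) (by
    rw [Set.disjoint_left]
    rintro _ hx ⟨k, rfl⟩
    exact hk k hx)
  have hgP : g ∉ P := fun hx => Set.disjoint_left.1 hd hx (Submonoid.mem_powers g)
  have hle := Ideal.toIdeal_homogeneousCore_le 𝒜 P
  have hgc : g ∉ (P.homogeneousCore 𝒜).toIdeal := fun hx => hgP (hle hx)
  refine h ⟨(P.homogeneousCore 𝒜).toIdeal, hP.homogeneousCore, (P.homogeneousCore 𝒜).isHomogeneous,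
    fun hirr => hgc (hirr hg')⟩ hgc ?_
  rw [← hI.toIdeal_homogeneousCore_eq_self]
  exact Ideal.homogeneousCore_mono 𝒜 hIP

/-- A point not containing `a` does not contain some homogeneous component of `a`. -/
theorem exists_decompose_notMem (p : RatProj 𝒜) {a : A} (ha : a ∉ p.asIdeal) :
    ∃ d : ℚ, (DirectSum.decompose 𝒜 a d : A) ∉ p.asIdeal := by
  classical
  by_contra! h
  refine ha ?_
  rw [← DirectSum.sum_support_decompose 𝒜 a]
  exact Ideal.sum_mem _ fun d _ => h d

/-- A homogeneous element whose germs on `D₊(g)` vanish is killed by a power of `g`. -/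
theorem exists_pow_mul_eq_zero {g : A} (hg' : g ∈ irrelevantIdeal 𝒜) {d : ℚ} {a : A} (ha : a ∈ 𝒜 d)
    (h : ∀ p : RatProj 𝒜, g ∉ p.asIdeal →
      algebraMap A (Localization.AtPrime p.asIdeal) a = 0) : ∃ k : ℕ, g ^ k * a = 0 := by
  let I : Ideal A := Ideal.span {t | SetLike.IsHomogeneousElem 𝒜 t ∧ t * a = 0}
  obtain ⟨k, hk⟩ := exists_pow_mem_of_not_le 𝒜 hg' (I := I)
    (Ideal.homogeneous_span 𝒜 _ fun t ht => ht.1) (by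
      intro p hp hle
      obtain ⟨⟨t, ht⟩, hta⟩ := (IsLocalization.map_eq_zero_iff p.asIdeal.primeCompl _ a).1 (h p hp)
      obtain ⟨e, he⟩ := exists_decompose_notMem 𝒜 p ht
      refine he (hle (Ideal.subset_span ⟨⟨e, SetLike.coe_mem _⟩, ?_⟩))
      rw [← DirectSum.coe_decompose_mul_add_of_right_mem 𝒜 ha]
      dsimp only at hta
      rw [hta]
      simp)
  refine ⟨k, ?_⟩
  have : I ≤ (Ideal.span {a}).annihilator := Ideal.span_le.2 fun t ht => by
    rw [SetLike.mem_coe, Submodule.mem_annihilator_span_singleton]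
    exact ht.2
  have := this hk
  rwa [Submodule.mem_annihilator_span_singleton] at this

/-- Near a point, a section of `𝒪(m)` is a fraction on some `D₊(t)`, and `t` can be taken in any
homogeneous ideal that does not contain the point. -/
theorem exists_isFraction_basicOpen {m : ℚ} {U : Opens (top 𝒜)} (f : sections 𝒜 m U)
    {e : ℚ} {g : A} (hg : g ∈ 𝒜 e) (hU : ∀ p : RatProj 𝒜, g ∉ p.asIdeal → p ∈ U)
    (p : RatProj 𝒜) (hp : g ∉ p.asIdeal) :
    ∃ (b : A) (d : ℚ) (a : A), b * g ∈ 𝒜 d ∧ a ∈ 𝒜 (m + d) ∧ b * g ∉ p.asIdeal ∧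
      ∀ (q : RatProj 𝒜) (hq : g ∉ q.asIdeal), b * g ∉ q.asIdeal →
        algebraMap A (Localization.AtPrime q.asIdeal) (b * g) * f.1 ⟨q, hU q hq⟩ =
          algebraMap A (Localization.AtPrime q.asIdeal) a := by
  obtain ⟨V, hpV, i, d, r, s, hs, w⟩ := f.2 ⟨p, hU p hp⟩
  obtain ⟨W, hW, hWV⟩ := V.2
  have hpW : toPrimeSpectrum 𝒜 p ∈ W := by
    have : p ∈ (V : Set (RatProj 𝒜)) := hpV
    rw [← Opens.carrier_eq_coe, ← hWV] at this
    exact this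
  obtain ⟨_, ⟨h, rfl⟩, hph, hhW⟩ :=
    PrimeSpectrum.isTopologicalBasis_basic_opens.exists_subset_of_mem_open hpW hW
  obtain ⟨c, hc⟩ := exists_decompose_notMem 𝒜 p (a := h) hph
  let t : A := ((DirectSum.decompose 𝒜 h c : 𝒜 c) : A)
  have htc : t ∈ 𝒜 c := SetLike.coe_mem _
  refine ⟨t * s, c + d + e, t * r * g, SetLike.mul_mem_graded (SetLike.mul_mem_graded htc s.2) hg,
    ?_, ?_, ?_⟩
  · have := SetLike.mul_mem_graded (SetLike.mul_mem_graded htc r.2) hg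
    rwa [show c + (m + d) + e = m + (c + d + e) by ring] at this
  · exact p.asIdeal.primeCompl.mul_mem (p.asIdeal.primeCompl.mul_mem hc (hs ⟨p, hpV⟩)) hp
  · intro q hq hqt
    have hth : t ∉ q.asIdeal := fun h0 =>
      hqt (Ideal.mul_mem_right _ _ (Ideal.mul_mem_right _ _ h0))
    have hqh : h ∉ q.asIdeal := fun h0 => hth (q.isHomogeneous c h0)
    have hqV : q ∈ V := by
      have : q ∈ (toPrimeSpectrum 𝒜) ⁻¹' W := hhW hqh
      rw [hWV] at this
      exact this
    have h1 : f.1 ⟨q, hU q hq⟩ = _ := w ⟨q, hqV⟩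
    have h2 : algebraMap A (Localization.AtPrime q.asIdeal) s * f.1 ⟨q, hU q hq⟩ =
        algebraMap A (Localization.AtPrime q.asIdeal) r := by
      rw [h1, Localization.mk_eq_mk']
      exact IsLocalization.mk'_spec' (Localization.AtPrime q.asIdeal) (r : A)
        (⟨s, hs ⟨q, hqV⟩⟩ : q.asIdeal.primeCompl)
    rw [map_mul, map_mul, map_mul, map_mul, ← h2]
    ring

/-- The sections of `𝒪(m)` over `D₊(g)` are the fractions `a / g ^ k` with `a` homogeneous of degree
`m + k * deg g`. -/
theorem exists_pow_mul_eq {m : ℚ} {U : Opens (top 𝒜)} (f : sections 𝒜 m U)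
    {e : ℚ} {g : A} (hg : g ∈ 𝒜 e) (hg' : g ∈ irrelevantIdeal 𝒜)
    (hU : ∀ p : RatProj 𝒜, g ∉ p.asIdeal → p ∈ U) :
    ∃ (k : ℕ), ∃ a ∈ 𝒜 (m + k • e), ∀ (p : RatProj 𝒜) (hp : g ∉ p.asIdeal),
      algebraMap A (Localization.AtPrime p.asIdeal) (g ^ k) * f.1 ⟨p, hU p hp⟩ =
        algebraMap A (Localization.AtPrime p.asIdeal) a := by
  classical
  let T : Set A := {t | g ∣ t ∧ ∃ d : ℚ, ∃ a : A, t ∈ 𝒜 d ∧ a ∈ 𝒜 (m + d) ∧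
    ∀ (q : RatProj 𝒜) (hq : g ∉ q.asIdeal), t ∉ q.asIdeal →
        algebraMap A (Localization.AtPrime q.asIdeal) t * f.1 ⟨q, hU q hq⟩ =
          algebraMap A (Localization.AtPrime q.asIdeal) a}
  -- Finitely many of the denominators in `T` suffice to cover `D₊(g)`.
  obtain ⟨k, hk⟩ := exists_pow_mem_of_not_le 𝒜 hg' (I := Ideal.span T)
    (Ideal.homogeneous_span 𝒜 _ fun t ht => ⟨_, ht.2.choose_spec.choose_spec.1⟩) (by
      intro p hp hle
      obtain ⟨b, d, a, h1, h2, h3, h4⟩ := exists_isFraction_basicOpen 𝒜 f hg hU p hp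
      exact h3 (hle (Ideal.subset_span ⟨dvd_mul_left _ _, d, a, h1, h2, h4⟩)))
  obtain ⟨F, hFT, hkF⟩ := Submodule.mem_span_finite_of_mem_span hk
  have hcov : ∀ p : RatProj 𝒜, g ∉ p.asIdeal → ∃ t ∈ F, t ∉ p.asIdeal := by
    intro p hp
    by_contra! h
    exact hp (p.isPrime.mem_of_pow_mem k ((Ideal.span_le.2 fun t ht => h t ht) hkF))
  choose! hgT d a htd ha hfa using fun t (ht : t ∈ F) => hFT ht
  have hirr : ∀ t ∈ F, t ∈ irrelevantIdeal 𝒜 := fun t ht =>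
    Ideal.mem_of_dvd _ (hgT t ht) hg'
  -- The fractions agree on overlaps, up to a power of the denominators.
  have hpair : ∀ t ∈ F, ∀ s ∈ F, ∃ N : ℕ, (t * s) ^ N * (s * a t - t * a s) = 0 := by
    intro t ht s hs
    refine exists_pow_mul_eq_zero 𝒜 (Ideal.mul_mem_left _ _ (hirr s hs)) (d := m + d t + d s) (sub_mem ?_ ?_) ?_
    · have := SetLike.mul_mem_graded (htd s hs) (ha t ht)
      rwa [show d s + (m + d t) = m + d t + d s by ring] at this
    · have := SetLike.mul_mem_graded (htd t ht) (ha s hs)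
      rwa [show d t + (m + d s) = m + d t + d s by ring] at this
    · intro p hp
      have htp : t ∉ p.asIdeal := fun h => hp (Ideal.mul_mem_right _ _ h)
      have hsp : s ∉ p.asIdeal := fun h => hp (Ideal.mul_mem_left _ _ h)
      have hgp : g ∉ p.asIdeal := fun h => htp (Ideal.mem_of_dvd _ (hgT t ht) h)
      rw [map_sub, map_mul, map_mul, ← hfa t ht p hgp htp, ← hfa s hs p hgp hsp]
      ring
  choose! N0 hN0 using hpair
  obtain ⟨N, hN⟩ : ∃ N, ∀ t ∈ F, ∀ s ∈ F, (t * s) ^ N * (s * a t - t * a s) = 0 := by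
    refine ⟨F.sup fun t => F.sup fun s => N0 t s, fun t ht s hs => ?_⟩
    have hle : N0 t s ≤ F.sup fun t => F.sup fun s => N0 t s :=
      (Finset.le_sup (f := fun s => N0 t s) hs).trans
        (Finset.le_sup (f := fun t => F.sup fun s => N0 t s) ht)
    rw [← Nat.sub_add_cancel hle, pow_add, mul_assoc, hN0 t ht s hs, mul_zero]
  obtain ⟨K, hK⟩ := exists_pow_mem_of_not_le 𝒜 hg'
    (I := Ideal.span ((fun t => t ^ (N + 1)) '' (F : Set A)))
    (Ideal.homogeneous_span 𝒜 _ (by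
      rintro _ ⟨t, ht, rfl⟩
      exact ⟨_, SetLike.pow_mem_graded _ (htd t ht)⟩)) (by
      intro p hp hle
      obtain ⟨t, ht, htp⟩ := hcov p hp
      exact htp (p.isPrime.mem_of_pow_mem _ (hle (Ideal.subset_span ⟨t, ht, rfl⟩))))
  obtain ⟨c, hc⟩ := (Submodule.mem_span_image_finset_iff_exists_fun A).1 hK
  -- With `g ^ K = ∑ c_t t ^ (N + 1)`, the numerators glue to `∑ c_t t ^ N a_t`.
  let b : A := ∑ t : F, c t * (t : A) ^ N * a t
  have hb : ∀ s ∈ F, s ^ (N + 1) * b = g ^ K * s ^ N * a s := by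
    intro s hs
    rw [← hc, Finset.mul_sum, Finset.sum_mul, Finset.sum_mul]
    refine Finset.sum_congr rfl fun t _ => ?_
    have := hN t t.2 s hs
    rw [smul_eq_mul]
    linear_combination c t * this
  refine ⟨K, DirectSum.decompose 𝒜 b (m + K • e), SetLike.coe_mem _, fun p hp => ?_⟩
  obtain ⟨s, hs, hsp⟩ := hcov p hp
  have hb' : s ^ (N + 1) * (DirectSum.decompose 𝒜 b (m + K • e) : A) = g ^ K * s ^ N * a s := by
    rw [← DirectSum.coe_decompose_mul_add_of_left_mem 𝒜 (SetLike.pow_mem_graded (N + 1) (htd s hs)),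
      hb s hs]
    refine DirectSum.decompose_of_mem_same 𝒜 ?_
    have := SetLike.mul_mem_graded (SetLike.mul_mem_graded (SetLike.pow_mem_graded K hg)
      (SetLike.pow_mem_graded N (htd s hs))) (ha s hs)
    rwa [show K • e + N • d s + (m + d s) = (N + 1) • d s + (m + K • e) by
      rw [add_smul, one_smul]; ring] at this
  have hunit : IsUnit (algebraMap A (Localization.AtPrime p.asIdeal) (s ^ (N + 1))) :=
    IsLocalization.map_units _ (⟨s ^ (N + 1), pow_mem (S := p.asIdeal.primeCompl) hsp _⟩ :
      p.asIdeal.primeCompl)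
  refine hunit.mul_left_cancel ?_
  rw [← map_mul _ _ (DirectSum.decompose 𝒜 b (m + K • e) : A), hb', map_mul _ _ (a s),
    ← hfa s hs p hp hsp]
  simp only [map_mul, map_pow]
  ring

end RatProj

/-! ### Laurent expansions of sections -/

section Laurent

variable (σ : Type) (R : Type u) [CommRing R]

/-- Polynomials in the variables `X_s` with arbitrary, possibly negative, rational exponents. -/
abbrev LaurentRing : Type u :=
  AddMonoidAlgebra R (σ →₀ ℚ)

/-- Non-negative exponent vectors, as exponent vectors of arbitrary sign. -/
noncomputable def expCoe : (σ →₀ ℚ≥0) →+ (σ →₀ ℚ) :=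
  Finsupp.mapRange.addMonoidHom (NNRat.coeHom : ℚ≥0 →+* ℚ).toAddMonoidHom

/-- The inclusion `R[X_σ]_ℚ → R[X_σ ^ ±1]_ℚ`. -/
noncomputable def toLaurent : RatMvPolynomial σ R →ₐ[R] LaurentRing σ R :=
  AddMonoidAlgebra.mapDomainAlgHom R R (expCoe σ)

variable {σ R}

@[simp]
theorem expCoe_apply (w : σ →₀ ℚ≥0) (s : σ) : expCoe σ w s = w s := rfl

theorem expCoe_injective : Function.Injective (expCoe σ) := fun _ _ h =>
  Finsupp.ext fun s => NNRat.coe_injective (DFunLike.congr_fun h s)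

theorem degree_expCoe (w : σ →₀ ℚ≥0) : (expCoe σ w).degree = monomialDegree σ w := by
  have : (Finsupp.degree (R := ℚ)).comp (expCoe σ) = monomialDegree σ := by
    refine Finsupp.addHom_ext fun s a => ?_
    simp [expCoe, monomialDegree]
  exact DFunLike.congr_fun this w

theorem toLaurent_injective : Function.Injective (toLaurent σ R) :=
  AddMonoidAlgebra.mapDomain_injective expCoe_injective

theorem toLaurent_single (w : σ →₀ ℚ≥0) (r : R) :
    toLaurent σ R (AddMonoidAlgebra.single w r) = AddMonoidAlgebra.single (expCoe σ w) r :=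
  AddMonoidAlgebra.mapDomain_single

theorem coeff_toLaurent_ne_zero {a : RatMvPolynomial σ R} {v : σ →₀ ℚ}
    (h : (toLaurent σ R a).coeff v ≠ 0) : ∃ w ∈ a.coeff.support, expCoe σ w = v := by
  classical
  have := Finsupp.mapDomain_support (Finsupp.mem_support_iff.2 h)
  simpa using this

theorem isUnit_laurent_single (v : σ →₀ ℚ) :
    IsUnit (AddMonoidAlgebra.single v 1 : LaurentRing σ R) := by
  refine IsUnit.of_mul_eq_one (AddMonoidAlgebra.single (-v) 1) ?_
  rw [AddMonoidAlgebra.single_mul_single, add_neg_cancel, mul_one, AddMonoidAlgebra.one_def]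

theorem single_mem_ratHomogeneous (w : σ →₀ ℚ≥0) (r : R) :
    (AddMonoidAlgebra.single w r : RatMvPolynomial σ R) ∈
      ratHomogeneous σ R (monomialDegree σ w) :=
  AddMonoidAlgebra.single_mem_gradeBy _ _ _

/-- A prime ideal containing none of the variables `X_s`, `s ∈ J`, contains no monomial in
fractional powers of these variables. -/
theorem single_notMem {P : Ideal (RatMvPolynomial σ R)} [P.IsPrime] {J : Set σ}
    (hJ : ∀ s ∈ J, RatMvPolynomial.X R s ∉ P) {w : σ →₀ ℚ≥0} (hw : (w.support : Set σ) ⊆ J) :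
    (AddMonoidAlgebra.single w 1 : RatMvPolynomial σ R) ∉ P := by
  classical
  -- Every fractional power `X_s ^ a` divides an integral power of `X_s`.
  have key : ∀ s ∈ J, ∀ a : ℚ≥0, RatMvPolynomial.Xpow R s a ∉ P := by
    intro s hs a ha
    obtain ⟨k, hk⟩ := exists_nat_ge a
    refine hJ s hs (‹P.IsPrime›.mem_of_pow_mem k ?_)
    have : RatMvPolynomial.X R s ^ k =
        RatMvPolynomial.Xpow R s (k - a) * RatMvPolynomial.Xpow R s a := by
      simp only [RatMvPolynomial.Xpow, RatMvPolynomial.X, AddMonoidAlgebra.single_pow,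
        AddMonoidAlgebra.single_mul_single, one_pow, mul_one, ← Finsupp.single_add,
        tsub_add_cancel_of_le hk, Finsupp.smul_single, nsmul_eq_mul]
    rw [this]
    exact P.mul_mem_left _ ha
  induction w using Finsupp.induction with
  | zero => exact (Ideal.ne_top_iff_one _).1 ‹P.IsPrime›.ne_top
  | single_add s a w hsw ha ih =>
    have hsupp := Finsupp.support_single_add hsw ha
    rw [hsupp, Finset.coe_cons, Set.insert_subset_iff] at hw
    have : (AddMonoidAlgebra.single (Finsupp.single s a + w) 1 : RatMvPolynomial σ R) =
        RatMvPolynomial.Xpow R s a * AddMonoidAlgebra.single w 1 := by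
      rw [RatMvPolynomial.Xpow, AddMonoidAlgebra.single_mul_single, mul_one]
    rw [this]
    exact P.primeCompl.mul_mem (key s hw.1 a) (ih hw.2)

end Laurent

section Expansion

open RatProj

variable {σ : Type} {R : Type u} [CommRing R]

/-- The section `f` of `𝒪(m)` over `U` has the Laurent expansion `x`: for some monomial `X ^ w` in the
variables indexed by `J`, both `X ^ w * f` and `X ^ w * x` are one and the same homogeneous polynomial
of degree `m + deg w`. -/
def HasLaurentExpansion (J : Set σ) (m : ℚ) (U : Opens (RatProj.top (ratHomogeneous σ R)))
    (f : sections (ratHomogeneous σ R) m U) (x : LaurentRing σ R) : Prop :=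
  ∃ w : σ →₀ ℚ≥0, (w.support : Set σ) ⊆ J ∧
    ∃ a ∈ ratHomogeneous σ R (m + monomialDegree σ w),
      (∀ p : U, algebraMap (RatMvPolynomial σ R) (Localization.AtPrime p.1.asIdeal)
        (AddMonoidAlgebra.single w 1) * f.1 p = algebraMap _ _ a) ∧
      AddMonoidAlgebra.single (expCoe σ w) 1 * x = toLaurent σ R a

theorem mul_mul_add_of_mul_eq {B : Type*} [CommRing B] {u u' f f' a a' : B} (h : u * f = a)
    (h' : u' * f' = a') : u * u' * (f + f') = u' * a + u * a' := by
  rw [← h, ← h']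
  ring

theorem HasLaurentExpansion.zero (J : Set σ) (m : ℚ)
    (U : Opens (RatProj.top (ratHomogeneous σ R))) :
    HasLaurentExpansion J m U 0 0 :=
  ⟨0, by simp, 0, zero_mem _, fun p => by
    rw [map_zero]
    exact mul_zero _, by rw [map_zero (toLaurent σ R), mul_zero]⟩

theorem HasLaurentExpansion.add {J : Set σ} {m : ℚ}
    {U : Opens (RatProj.top (ratHomogeneous σ R))} {f f' : sections (ratHomogeneous σ R) m U}
    {x x' : LaurentRing σ R} (h : HasLaurentExpansion J m U f x)
    (h' : HasLaurentExpansion J m U f' x') : HasLaurentExpansion J m U (f + f') (x + x') := by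
  classical
  obtain ⟨w, hw, a, ha, hfa, hxa⟩ := h
  obtain ⟨w', hw', a', ha', hfa', hxa'⟩ := h'
  have hww : (AddMonoidAlgebra.single (w + w') 1 : RatMvPolynomial σ R) =
      AddMonoidAlgebra.single w 1 * AddMonoidAlgebra.single w' 1 := by
    rw [AddMonoidAlgebra.single_mul_single, mul_one]
  refine ⟨w + w', ?_, AddMonoidAlgebra.single w' 1 * a + AddMonoidAlgebra.single w 1 * a',
    add_mem ?_ ?_, fun p => ?_, ?_⟩
  · refine (Finset.coe_subset.2 Finsupp.support_add).trans ?_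
    rw [Finset.coe_union]
    exact Set.union_subset hw hw'
  · have := SetLike.mul_mem_graded (single_mem_ratHomogeneous w' (1 : R)) ha
    rwa [show monomialDegree σ w' + (m + monomialDegree σ w) = m + monomialDegree σ (w + w') by
      rw [map_add]; ring] at this
  · have := SetLike.mul_mem_graded (single_mem_ratHomogeneous w (1 : R)) ha'
    rwa [show monomialDegree σ w + (m + monomialDegree σ w') = m + monomialDegree σ (w + w') by
      rw [map_add]; ring] at this
  · rw [hww, map_mul, map_add (algebraMap _ _), map_mul, map_mul]
    exact mul_mul_add_of_mul_eq (hfa p) (hfa' p)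
  · rw [← toLaurent_single, hww, map_mul, map_add (toLaurent σ R), map_mul, map_mul,
      toLaurent_single, toLaurent_single]
    exact mul_mul_add_of_mul_eq hxa hxa'

theorem HasLaurentExpansion.smul {J : Set σ} {m : ℚ}
    {U : Opens (RatProj.top (ratHomogeneous σ R))} {f : sections (ratHomogeneous σ R) m U}
    {x : LaurentRing σ R} (c : R) (h : HasLaurentExpansion J m U f x) :
    HasLaurentExpansion J m U (c • f) (c • x) := by
  obtain ⟨w, hw, a, ha, hfa, hxa⟩ := h
  refine ⟨w, hw, c • a, Submodule.smul_mem _ _ ha, fun p => ?_, ?_⟩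
  · have hc : algebraMap (RatMvPolynomial σ R) (Localization.AtPrime p.1.asIdeal) (c • a) =
        c • algebraMap (RatMvPolynomial σ R) (Localization.AtPrime p.1.asIdeal) a := by
      rw [Algebra.algebraMap_eq_smul_one, Algebra.algebraMap_eq_smul_one, smul_assoc]
    rw [hc, ← hfa p]
    exact mul_smul_comm c _ (f.1 p)
  · rw [map_smul, ← hxa]
    exact mul_smul_comm c _ x

/-- The relation `HasLaurentExpansion`, as a submodule. -/
noncomputable def laurentExpansion (J : Set σ) (m : ℚ)
    (U : Opens (RatProj.top (ratHomogeneous σ R))) :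
    Submodule R (sections (ratHomogeneous σ R) m U × LaurentRing σ R) where
  carrier := {fx | HasLaurentExpansion J m U fx.1 fx.2}
  zero_mem' := .zero J m U
  add_mem' h h' := .add h h'
  smul_mem' c _ h := .smul c h

variable {J J' : Set σ} {m : ℚ} {U V : Opens (RatProj.top (ratHomogeneous σ R))}

theorem laurentExpansion_restrict (hJ : J ⊆ J') (i : op U ⟶ op V)
    {f : sections (ratHomogeneous σ R) m U} {x : LaurentRing σ R}
    (h : (f, x) ∈ laurentExpansion J m U) :
    ((twistingPresheaf (ratHomogeneous σ R) m).map i f, x) ∈ laurentExpansion J' m V := by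
  obtain ⟨w, hw, a, ha, hfa, hxa⟩ := h
  exact ⟨w, hw.trans hJ, a, ha, fun p => hfa ⟨p.1, i.unop.le p.2⟩, hxa⟩

theorem eq_zero_of_laurentExpansion (hU : ∀ p ∈ U, ∀ s ∈ J, RatMvPolynomial.X R s ∉ p.asIdeal)
    {f : sections (ratHomogeneous σ R) m U}
    (h : (f, (0 : LaurentRing σ R)) ∈ laurentExpansion J m U) : f = 0 := by
  obtain ⟨w, hw, a, ha, hfa, hxa⟩ := h
  have ha0 : a = 0 := toLaurent_injective (by rw [← hxa, map_zero]; exact mul_zero _)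
  refine Subtype.ext (funext fun p => ?_)
  have hunit : IsUnit (algebraMap _ (Localization.AtPrime p.1.asIdeal)
      (AddMonoidAlgebra.single w 1 : RatMvPolynomial σ R)) :=
    IsLocalization.map_units _ (⟨_, single_notMem (hU p.1 p.2) hw⟩ : p.1.asIdeal.primeCompl)
  refine hunit.mul_left_cancel ((hfa p).trans ?_)
  rw [ha0, map_zero]
  exact (mul_zero _).symm

/-- A section is determined by its Laurent expansion. -/
theorem eq_of_laurentExpansion (hU : ∀ p ∈ U, ∀ s ∈ J, RatMvPolynomial.X R s ∉ p.asIdeal)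
    {f g : sections (ratHomogeneous σ R) m U} {x y : LaurentRing σ R} (hxy : x = y)
    (hf : (f, x) ∈ laurentExpansion J m U) (hg : (g, y) ∈ laurentExpansion J m U) : f = g := by
  subst hxy
  have h := sub_mem hf hg
  rw [Prod.mk_sub_mk, sub_self] at h
  exact sub_eq_zero.1 (eq_zero_of_laurentExpansion hU h)

/-- The exponents in the expansion of a section of `𝒪(m)` have total degree `m`, and only those
of the inverted variables can be negative. -/
theorem of_mem_support_laurentExpansion {f : sections (ratHomogeneous σ R) m U}
    {x : LaurentRing σ R} (h : (f, x) ∈ laurentExpansion J m U) {v : σ →₀ ℚ} (hv : x.coeff v ≠ 0) :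
    v.degree = m ∧ ∀ s ∉ J, 0 ≤ v s := by
  obtain ⟨w, hw, a, ha, -, hxa⟩ := h
  have hne : (toLaurent σ R a).coeff (expCoe σ w + v) ≠ 0 := by
    rw [← hxa]
    dsimp only
    rwa [AddMonoidAlgebra.coeff_single_mul_add, one_mul]
  obtain ⟨u, hu, huv⟩ := coeff_toLaurent_ne_zero hne
  constructor
  · have h1 := congrArg Finsupp.degree huv
    rw [map_add, degree_expCoe, degree_expCoe, ha u hu] at h1
    linarith
  · intro s hs
    have h1 := DFunLike.congr_fun huv s
    have hws : w s = 0 := by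
      by_contra h0
      exact hs (hw (Finsupp.mem_support_iff.2 h0))
    rw [Finsupp.add_apply, expCoe_apply, expCoe_apply, hws, NNRat.cast_zero, zero_add] at h1
    rw [← h1]
    exact (u s).2

/-- Every Laurent polynomial of degree `m` whose negative exponents are at inverted variables is the
expansion of a section of `𝒪(m)`. -/
theorem exists_section_of_laurent
    (hU : ∀ p ∈ U, ∀ s ∈ J, RatMvPolynomial.X R s ∉ p.asIdeal) (x : LaurentRing σ R)
    (hx : ∀ v : σ →₀ ℚ, x.coeff v ≠ 0 → v.degree = m ∧ ∀ s ∉ J, 0 ≤ v s) :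
    ∃ f : sections (ratHomogeneous σ R) m U, (f, x) ∈ laurentExpansion J m U := by
  suffices x ∈ (laurentExpansion J m U).map (LinearMap.snd R _ _) by
    obtain ⟨⟨f, x'⟩, h, rfl⟩ := this
    exact ⟨f, h⟩
  rw [← AddMonoidAlgebra.sum_coeff_single x]
  refine Submodule.sum_mem _ fun v hv => ?_
  obtain ⟨hdeg, hpos⟩ := hx v (Finsupp.mem_support_iff.1 hv)
  -- Split the exponent vector into its positive and negative parts.
  let w : σ →₀ ℚ≥0 := v.mapRange (fun q => (-q).toNNRat) (by rw [neg_zero, Rat.toNNRat_zero])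
  let u : σ →₀ ℚ≥0 := v.mapRange (fun q => q.toNNRat) Rat.toNNRat_zero
  have huv : expCoe σ w + v = expCoe σ u := by
    ext s
    change max (-v s) (0 : ℚ) + v s = max (v s) (0 : ℚ)
    rcases le_total 0 (v s) with h | h
    · rw [max_eq_right (neg_nonpos.2 h), max_eq_left h, zero_add]
    · rw [max_eq_left (neg_nonneg.2 h), max_eq_right h, neg_add_cancel]
  have hw : (w.support : Set σ) ⊆ J := by
    intro s hs
    by_contra hsJ
    refine (Finsupp.mem_support_iff.1 hs) ?_
    simpa [w] using hpos s hsJ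
  have hdu : monomialDegree σ u = m + monomialDegree σ w := by
    rw [← degree_expCoe, ← degree_expCoe, ← huv, map_add, hdeg, add_comm]
  let r : RatMvPolynomial σ R := AddMonoidAlgebra.single u (x.coeff v)
  have hr : r ∈ ratHomogeneous σ R (m + monomialDegree σ w) :=
    hdu ▸ single_mem_ratHomogeneous u _
  have hs : ∀ p : U, (AddMonoidAlgebra.single w 1 : RatMvPolynomial σ R) ∉ p.1.asIdeal :=
    fun p => single_notMem (hU p.1 p.2) hw
  refine ⟨(⟨fun p => Localization.mk r ⟨_, hs p⟩, fun p => ⟨U, p.2, 𝟙 U, monomialDegree σ w,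
    ⟨r, hr⟩, ⟨_, single_mem_ratHomogeneous w 1⟩, hs, fun q => rfl⟩⟩, _),
    ⟨w, hw, r, hr, fun p => ?_, ?_⟩, rfl⟩
  · dsimp only
    rw [Localization.mk_eq_mk']
    exact IsLocalization.mk'_spec' (Localization.AtPrime p.1.asIdeal) r
      (⟨_, hs p⟩ : p.1.asIdeal.primeCompl)
  · rw [toLaurent_single, ← huv]
    exact (AddMonoidAlgebra.single_mul_single (expCoe σ w) v 1 (x.coeff v)).trans (by rw [one_mul])

section Cover

variable [Finite σ]

/-- The product of the variables `X_s`, `s ∈ J`, as a single monomial. -/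
noncomputable def varProd (σ : Type) [Finite σ] (J : Set σ) : σ →₀ ℚ≥0 :=
  Finsupp.equivFunOnFinite.symm (J.indicator 1)

theorem support_nsmul_varProd (k : ℕ) : ((k • varProd σ J).support : Set σ) ⊆ J := by
  intro s hs
  by_contra hsJ
  exact Finsupp.mem_support_iff.1 hs (by simp [varProd, hsJ])

theorem single_varProd_notMem_iff {P : Ideal (RatMvPolynomial σ R)} [P.IsPrime] :
    (AddMonoidAlgebra.single (varProd σ J) 1 : RatMvPolynomial σ R) ∉ P ↔
      ∀ s ∈ J, RatMvPolynomial.X R s ∉ P := by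
  refine ⟨fun h s hs hsP => h ?_, fun h =>
    single_notMem h (by simpa using support_nsmul_varProd (J := J) 1)⟩
  have hle : Finsupp.single s 1 ≤ varProd σ J := by
    rw [Finsupp.single_le_iff]
    simp [varProd, hs]
  have : (AddMonoidAlgebra.single (varProd σ J) 1 : RatMvPolynomial σ R) =
      AddMonoidAlgebra.single (varProd σ J - Finsupp.single s 1) 1 * RatMvPolynomial.X R s := by
    rw [RatMvPolynomial.X, RatMvPolynomial.Xpow, AddMonoidAlgebra.single_mul_single, mul_one,
      tsub_add_cancel_of_le hle]
  rw [this]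
  exact P.mul_mem_left _ hsP

theorem single_varProd_mem_irrelevantIdeal (hJ : J.Nonempty) :
    (AddMonoidAlgebra.single (varProd σ J) 1 : RatMvPolynomial σ R) ∈
      irrelevantIdeal (ratHomogeneous σ R) := by
  refine Ideal.subset_span ⟨_, ?_, single_mem_ratHomogeneous _ _⟩
  obtain ⟨s, hs⟩ := hJ
  rw [monomialDegree, AddMonoidHom.comp_apply]
  refine NNRat.coe_pos.2 (pos_iff_ne_zero.2 fun h => ?_)
  have := (Finsupp.degree_eq_zero_iff _).1 h
  have := DFunLike.congr_fun this s
  simp [varProd, hs] at this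

/-- The Laurent expansion of a section over `⋂ D₊(X_s)` is unique. -/
theorem eq_zero_of_laurentExpansion_zero (hJ : J.Nonempty)
    (hU : ∀ p : RatProj (ratHomogeneous σ R),
      (∀ s ∈ J, RatMvPolynomial.X R s ∉ p.asIdeal) → p ∈ U)
    {f : sections (ratHomogeneous σ R) m U} {x : LaurentRing σ R} (hf : f = 0)
    (h : (f, x) ∈ laurentExpansion J m U) : x = 0 := by
  subst hf
  obtain ⟨w, hw, a, ha, hfa, hxa⟩ := h
  obtain ⟨k, hk⟩ := exists_pow_mul_eq_zero (ratHomogeneous σ R)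
    (single_varProd_mem_irrelevantIdeal (R := R) hJ) ha fun p hp => by
      rw [← hfa ⟨p, hU p (single_varProd_notMem_iff.1 hp)⟩]
      exact mul_zero _
  have ha0 : toLaurent σ R a = 0 := by
    have := congrArg (toLaurent σ R) hk
    rw [map_mul, map_pow, toLaurent_single, map_zero] at this
    exact ((isUnit_laurent_single _).pow k).mul_right_eq_zero.1 this
  rw [ha0] at hxa
  exact (isUnit_laurent_single _).mul_right_eq_zero.1 hxa

/-- Every section over `⋂ D₊(X_s)` has a Laurent expansion. -/
theorem exists_laurentExpansion (hJ : J.Nonempty)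
    (hU : ∀ p : RatProj (ratHomogeneous σ R),
      p ∈ U ↔ ∀ s ∈ J, RatMvPolynomial.X R s ∉ p.asIdeal)
    (f : sections (ratHomogeneous σ R) m U) :
    ∃ x : LaurentRing σ R, (f, x) ∈ laurentExpansion J m U := by
  obtain ⟨k, a, ha, hfa⟩ := exists_pow_mul_eq (ratHomogeneous σ R) f
    (single_mem_ratHomogeneous (varProd σ J) (1 : R)) (single_varProd_mem_irrelevantIdeal hJ)
    fun p hp => (hU p).2 (single_varProd_notMem_iff.1 hp)
  rw [← map_nsmul] at ha
  refine ⟨AddMonoidAlgebra.single (-(expCoe σ (k • varProd σ J))) 1 * toLaurent σ R a,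
    k • varProd σ J, support_nsmul_varProd k, a, ha, fun p => ?_, ?_⟩
  · have := hfa p.1 (single_varProd_notMem_iff.2 ((hU p.1).1 p.2))
    rwa [AddMonoidAlgebra.single_pow, one_pow] at this
  · dsimp only
    rw [← mul_assoc, AddMonoidAlgebra.single_mul_single, add_neg_cancel, mul_one,
      ← AddMonoidAlgebra.one_def, one_mul]

end Cover

end Expansion

/-! ### The Čech complex of a presheaf of modules -/

section Cech

open Limits

variable {R : Type u} [CommRing R] {C : Type u} [SmallCategory C] [HasFiniteProducts C] {ι : Type}

/-- The map `U_{β 0} × ⋯ ⟶ U_{β (φ 0)} × ⋯` between products of a family of objects, induced by a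
map `φ` of index sets. -/
noncomputable def reindexMap (U : ι → C) {p q : ℕ} (β : Fin q → ι) (φ : Fin p → Fin q) :
    ∏ᶜ (U ∘ β) ⟶ ∏ᶜ (U ∘ (β ∘ φ)) :=
  Pi.lift fun a => Pi.π (U ∘ β) (φ a)

/-- The value of a presheaf on `U_{α 0} × ⋯ × U_{α p}`: the factor with index `α` of the module of
Čech `p`-cochains. -/
noncomputable abbrev cechFactor (U : ι → C) (P : Cᵒᵖ ⥤ ModuleCat.{u} R) (p : ℕ)
    (α : Fin (p + 1) → ι) : ModuleCat.{u} R :=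
  P.obj (op (∏ᶜ (U ∘ α)))

theorem sum_zsmul_hom_apply {M N : ModuleCat.{u} R} {κ : Type} [Fintype κ] (c : κ → ℤ)
    (φ : κ → (M ⟶ N)) (x : M) : (∑ k, c k • φ k : M ⟶ N).hom x = ∑ k, c k • (φ k).hom x := by
  simp [ModuleCat.hom_sum]

/-- The component of the Čech differential at `β` is the alternating sum of the restrictions of the
components at the faces of `β`. -/
theorem cech_d_π (U : ι → C) (P : Cᵒᵖ ⥤ ModuleCat.{u} R) (p : ℕ) (β : Fin (p + 2) → ι) :
    ((cechComplexFunctor U).obj P).d p (p + 1) ≫ Pi.π (cechFactor U P (p + 1)) β =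
      ∑ k : Fin (p + 2), (-1 : ℤ) ^ (k : ℕ) •
        (Pi.π (cechFactor U P p) (β ∘ k.succAbove) ≫ P.map (reindexMap U β k.succAbove).op) := by
  have h1 : ((cechComplexFunctor U).obj P).d p (p + 1) =
      AlgebraicTopology.AlternatingCofaceMapComplex.objD
        ((FormalCoproduct.cosimplicialObjectFunctor (FormalCoproduct.mk _ U).cech).obj P) p := by
    dsimp only [cechComplexFunctor, FormalCoproduct.cochainComplexFunctor, Functor.comp_obj,
      AlgebraicTopology.alternatingCofaceMapComplex,
      AlgebraicTopology.AlternatingCofaceMapComplex.obj]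
    rw [CochainComplex.of_d]
  have h2 : ∀ k : Fin (p + 2),
      ((FormalCoproduct.cosimplicialObjectFunctor (FormalCoproduct.mk _ U).cech).obj P).δ k ≫
        Pi.π (cechFactor U P (p + 1)) β =
      Pi.π (cechFactor U P p) (β ∘ k.succAbove) ≫ P.map (reindexMap U β k.succAbove).op :=
    fun k => Pi.lift_π _ _
  rw [h1, AlgebraicTopology.AlternatingCofaceMapComplex.objD]
  refine (Preadditive.sum_comp _ _ _).trans (Finset.sum_congr rfl fun k _ => ?_)
  exact (Preadditive.zsmul_comp _ _ _).trans (congrArg _ (h2 k))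

theorem cech_d_π_apply (U : ι → C) (P : Cᵒᵖ ⥤ ModuleCat.{u} R) (p : ℕ) (β : Fin (p + 2) → ι)
    (x : (∏ᶜ (cechFactor U P p) : ModuleCat.{u} R)) :
    Pi.π (cechFactor U P (p + 1)) β (((cechComplexFunctor U).obj P).d p (p + 1) x) =
      ∑ k : Fin (p + 2), (-1 : ℤ) ^ (k : ℕ) •
        P.map (reindexMap U β k.succAbove).op
          (Pi.π (cechFactor U P p) (β ∘ k.succAbove) x) := by
  refine (congrArg (fun φ => φ.hom x) (cech_d_π U P p β)).trans ?_
  exact sum_zsmul_hom_apply _ _ x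

/-- The Čech complex is exact in degree `q + 1` when every cocycle, given as a family of sections
over the `U_{α 0} × ⋯ × U_{α (q + 1)}`, is the coboundary of such a family. -/
theorem isZero_cech_homology (U : ι → C) (P : Cᵒᵖ ⥤ ModuleCat.{u} R) (q : ℕ)
    (H : ∀ c : ∀ α : Fin (q + 2) → ι, cechFactor U P (q + 1) α,
      (∀ β : Fin (q + 3) → ι, ∑ k : Fin (q + 3), (-1 : ℤ) ^ (k : ℕ) •
        P.map (reindexMap U β k.succAbove).op (c (β ∘ k.succAbove)) = 0) →
      ∃ b : ∀ α : Fin (q + 1) → ι, cechFactor U P q α,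
        ∀ β : Fin (q + 2) → ι, ∑ k : Fin (q + 2), (-1 : ℤ) ^ (k : ℕ) •
          P.map (reindexMap U β k.succAbove).op (b (β ∘ k.succAbove)) = c β) :
    IsZero (((cechComplexFunctor U).obj P).homology (q + 1)) := by
  refine (HomologicalComplex.exactAt_iff_isZero_homology _ _).1 ?_
  rw [HomologicalComplex.exactAt_iff' _ q (q + 1) (q + 2) (by simp) (by simp),
    ShortComplex.moduleCat_exact_iff]
  intro x hx
  obtain ⟨b, hb⟩ := H (fun α => Pi.π (cechFactor U P (q + 1)) α x) fun β => by
    rw [← cech_d_π_apply U P (q + 1) β x]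
    exact (congrArg (Pi.π (cechFactor U P (q + 2)) β) hx).trans (map_zero _)
  refine ⟨(ModuleCat.piIsoPi (cechFactor U P q)).inv b,
    Concrete.limit_ext (Discrete.functor (cechFactor U P (q + 1))) _ _ fun ⟨β⟩ => ?_⟩
  refine (cech_d_π_apply U P q β _).trans ?_
  refine Eq.trans (Finset.sum_congr rfl fun k _ => ?_) (hb β)
  rw [ModuleCat.piIsoPi_inv_kernel_ι_apply (cechFactor U P q) _ b]

end Cech

/-! ### Contraction of the Čech complex -/

section Homotopy

variable {ι : Type} {M : Type*} [AddCommGroup M]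

/-- In the complex of functions on tuples of indices, with no condition on their values, prepending
a fixed index to the tuples is a contraction: it turns a cocycle into a primitive of it. -/
theorem sum_cons_succAbove_eq_of_cocycle {q : ℕ} (x : (Fin (q + 2) → ι) → M) (s : ι)
    (β : Fin (q + 2) → ι)
    (hx : ∑ k : Fin (q + 3), (-1 : ℤ) ^ (k : ℕ) •
      x ((Fin.cons s β : Fin (q + 3) → ι) ∘ k.succAbove) = 0) :
    ∑ k : Fin (q + 2), (-1 : ℤ) ^ (k : ℕ) • x (Fin.cons s (β ∘ k.succAbove)) = x β := by
  rw [Fin.sum_univ_succ] at hx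
  have h0 : (Fin.cons s β : Fin (q + 3) → ι) ∘ (0 : Fin (q + 3)).succAbove = β := by
    funext j
    simp
  have h1 : ∀ k : Fin (q + 2), (Fin.cons s β : Fin (q + 3) → ι) ∘ k.succ.succAbove =
      Fin.cons s (β ∘ k.succAbove) := fun k => Fin.cons_comp_succ_succAbove s β k
  simp only [h0, h1, Fin.val_zero, pow_zero, one_smul, Fin.val_succ, pow_succ, mul_neg, mul_one,
    neg_smul, Finset.sum_neg_distrib] at hx
  exact (add_neg_eq_zero.1 hx).symm

theorem sum_zsmul_prod_mem {R : Type*} [CommRing R] {M N κ : Type*} [AddCommGroup M] [Module R M]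
    [AddCommGroup N] [Module R N] [Fintype κ] {S : Submodule R (M × N)} {f : κ → M} {g : κ → N}
    (c : κ → ℤ) (h : ∀ k, (f k, g k) ∈ S) : (∑ k, c k • f k, ∑ k, c k • g k) ∈ S := by
  have := S.sum_mem (t := Finset.univ) fun k _ => zsmul_mem (h k) (c k)
  convert this
  · exact (Prod.fst_sum (f := fun k => c k • (f k, g k))).symm
  · exact (Prod.snd_sum (f := fun k => c k • (f k, g k))).symm

/-- Exactness of the Čech complex of Laurent polynomials in degrees strictly between `0` and `n`.
The cochains split by exponent vectors `v`, and the part for `v` is contracted by prepending an index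
`s` with `v s ≥ 0`: inverting `X_s` does not affect whether `X ^ v` is allowed.  If `v` has only
negative entries, it occurs only when all `n + 1` variables are inverted, so not in these degrees. -/
theorem exists_laurent_primitive {n q : ℕ} (hq : q + 1 < n) {R : Type u} [CommRing R] {m : ℚ}
    (x : (Fin (q + 2) → Fin (n + 1)) → LaurentRing (Fin (n + 1)) R)
    (hx : ∀ α v, (x α).coeff v ≠ 0 → v.degree = m ∧ ∀ s ∉ Set.range α, 0 ≤ v s)
    (hxc : ∀ β : Fin (q + 3) → Fin (n + 1),
      ∑ k : Fin (q + 3), (-1 : ℤ) ^ (k : ℕ) • x (β ∘ k.succAbove) = 0) :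
    ∃ y : (Fin (q + 1) → Fin (n + 1)) → LaurentRing (Fin (n + 1)) R,
      (∀ α v, (y α).coeff v ≠ 0 → v.degree = m ∧ ∀ s ∉ Set.range α, 0 ≤ v s) ∧
      ∀ β : Fin (q + 2) → Fin (n + 1),
        ∑ k : Fin (q + 2), (-1 : ℤ) ^ (k : ℕ) • y (β ∘ k.succAbove) = x β := by
  classical
  -- For each exponent vector, a variable whose exponent is not negative, if there is one.
  have hs : ∀ v : Fin (n + 1) →₀ ℚ, ∃ s, 0 ≤ v s ∨ ∀ t, v t < 0 := by
    intro v
    by_cases h : ∃ s, 0 ≤ v s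
    · exact h.imp fun s hs => Or.inl hs
    · push Not at h
      exact ⟨0, Or.inr h⟩
  choose s hs using hs
  let y : (Fin (q + 1) → Fin (n + 1)) → LaurentRing (Fin (n + 1)) R := fun α =>
    ∑ t, .ofCoeff ((x (Fin.cons t α)).coeff.filter fun v => s v = t)
  have hy : ∀ α v, (y α).coeff v = (x (Fin.cons (s v) α)).coeff v := by
    intro α v
    simp only [y, AddMonoidAlgebra.coeff_sum, Finsupp.finsetSum_apply, Finsupp.filter_apply]
    rw [Finset.sum_ite_eq, if_pos (Finset.mem_univ _)]
  refine ⟨y, fun α v hv => ?_, fun β => ?_⟩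
  · rw [hy] at hv
    obtain ⟨hdeg, hpos⟩ := hx _ v hv
    refine ⟨hdeg, fun t ht => ?_⟩
    by_cases hts : t = s v
    · refine hts ▸ (hs v).resolve_right fun hneg => ?_
      -- All exponents are negative, so that all `n + 1` variables occur among `q + 2` indices.
      have hsurj : Function.Surjective (Fin.cons (s v) α : Fin (q + 2) → Fin (n + 1)) := by
        intro t'
        by_contra h
        exact (hneg t').not_ge (hpos t' h)
      have := Fintype.card_le_of_surjective _ hsurj
      simp only [Fintype.card_fin] at this
      omega
    · refine hpos t fun hmem => ?_
      rw [Fin.range_cons] at hmem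
      exact hmem.elim hts ht
  · ext v
    rw [← sum_cons_succAbove_eq_of_cocycle x (s v) β (hxc _)]
    simp only [AddMonoidAlgebra.coeff_sum, Finsupp.finsetSum_apply]
    refine Finset.sum_congr rfl fun k _ => ?_
    exact congrArg (fun r : R => (-1 : ℤ) ^ (k : ℕ) • r) (hy (β ∘ k.succAbove) v)

end Homotopy

section Vanishing

open RatProj Limits

variable (R : Type u) [CommRing R] (n : ℕ)

/-- The products in the Čech complex, taken in the category of open sets, are the intersections of
the sets `D₊(X_s)`. -/
theorem mem_prod_standardCover {p : ℕ} (α : Fin p → Fin (n + 1))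
    (x : RatProj (ratHomogeneous (Fin (n + 1)) R)) :
    x ∈ (∏ᶜ (standardCover R n ∘ α) : Opens (ratProjectiveSpace R n)) ↔
      ∀ s ∈ Set.range α, RatMvPolynomial.X R s ∉ x.asIdeal := by
  rw [Set.forall_mem_range]
  constructor
  · intro h a
    exact (Pi.π (standardCover R n ∘ α) a).le h
  · intro h
    let W : Opens (ratProjectiveSpace R n) := Finset.univ.inf (standardCover R n ∘ α)
    have hW : x ∈ W := by
      rw [← SetLike.mem_coe, Opens.coe_finset_inf, Finset.inf_set_eq_iInter]
      exact Set.mem_iInter₂.2 fun a _ => h a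
    exact (Pi.lift fun a => homOfLE (Finset.inf_le (Finset.mem_univ a)) :
      W ⟶ ∏ᶜ (standardCover R n ∘ α)).le hW

/-- The coboundary of a Čech cochain has as its expansions the coboundary of the expansions. -/
theorem hasLaurentExpansion_coboundary {m : ℚ} {p : ℕ}
    (c : ∀ α : Fin (p + 1) → Fin (n + 1), cechFactor (standardCover R n)
      (twistingPresheaf (ratHomogeneous (Fin (n + 1)) R) m) p α)
    (x : (Fin (p + 1) → Fin (n + 1)) → LaurentRing (Fin (n + 1)) R)
    (h : ∀ α, (c α, x α) ∈ laurentExpansion (Set.range α) m (∏ᶜ (standardCover R n ∘ α)))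
    (β : Fin (p + 2) → Fin (n + 1)) :
    (∑ k : Fin (p + 2), (-1 : ℤ) ^ (k : ℕ) •
        (twistingPresheaf (ratHomogeneous (Fin (n + 1)) R) m).map
          (reindexMap (standardCover R n) β k.succAbove).op (c (β ∘ k.succAbove)),
      ∑ k : Fin (p + 2), (-1 : ℤ) ^ (k : ℕ) • x (β ∘ k.succAbove)) ∈
      laurentExpansion (Set.range β) m (∏ᶜ (standardCover R n ∘ β)) := by
  exact sum_zsmul_prod_mem _ fun k =>
    laurentExpansion_restrict (Set.range_comp_subset_range _ _) _ (h _)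

/-- Čech cocycles of `𝒪(m)` in degrees strictly between `0` and `n` are coboundaries: take Laurent
expansions, contract there, and go back to sections. -/
theorem exists_cech_primitive {m : ℚ} {q : ℕ} (hq : q + 1 < n)
    (c : ∀ α : Fin (q + 2) → Fin (n + 1), cechFactor (standardCover R n)
      (twistingPresheaf (ratHomogeneous (Fin (n + 1)) R) m) (q + 1) α)
    (hc : ∀ β : Fin (q + 3) → Fin (n + 1), ∑ k : Fin (q + 3), (-1 : ℤ) ^ (k : ℕ) •
      (twistingPresheaf (ratHomogeneous (Fin (n + 1)) R) m).map
        (reindexMap (standardCover R n) β k.succAbove).op (c (β ∘ k.succAbove)) = 0) :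
    ∃ b : ∀ α : Fin (q + 1) → Fin (n + 1), cechFactor (standardCover R n)
      (twistingPresheaf (ratHomogeneous (Fin (n + 1)) R) m) q α,
      ∀ β : Fin (q + 2) → Fin (n + 1), ∑ k : Fin (q + 2), (-1 : ℤ) ^ (k : ℕ) •
        (twistingPresheaf (ratHomogeneous (Fin (n + 1)) R) m).map
          (reindexMap (standardCover R n) β k.succAbove).op (b (β ∘ k.succAbove)) = c β := by
  have hx : ∀ α, ∃ x, (c α, x) ∈
      laurentExpansion (Set.range α) m (∏ᶜ (standardCover R n ∘ α)) := fun α =>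
    exists_laurentExpansion (Set.range_nonempty α) (mem_prod_standardCover R n α) (c α)
  choose x hx using hx
  have hxc : ∀ β : Fin (q + 3) → Fin (n + 1),
      ∑ k : Fin (q + 3), (-1 : ℤ) ^ (k : ℕ) • x (β ∘ k.succAbove) = 0 := by
    intro β
    exact eq_zero_of_laurentExpansion_zero (Set.range_nonempty β)
      (fun p => (mem_prod_standardCover R n β p).2) (hc β)
      (hasLaurentExpansion_coboundary R n c x hx β)
  obtain ⟨y, hy, hyx⟩ := exists_laurent_primitive hq x
    (fun α v hv => of_mem_support_laurentExpansion (hx α) hv) hxc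
  have hb : ∀ α, ∃ f, (f, y α) ∈
      laurentExpansion (Set.range α) m (∏ᶜ (standardCover R n ∘ α)) := fun α =>
    exists_section_of_laurent (fun p hp => (mem_prod_standardCover R n α p).1 hp) _ (hy α)
  choose b hb using hb
  refine ⟨b, fun β => ?_⟩
  exact eq_of_laurentExpansion (fun p hp => (mem_prod_standardCover R n β p).1 hp) (hyx β)
    (hasLaurentExpansion_coboundary R n b y hb β) (hx β)

end Vanishing

end RationalDegree

theorem mainTheorem3 (R : Type u) [CommRing R] (n : ℕ) (m : ℚ) (i : ℕ) (hi : 0 < i) (hin : i < n) :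
    CategoryTheory.Limits.IsZero
      (RationalDegree.cechCohomology (RationalDegree.standardCover R n)
        (RationalDegree.twistingSheafOnProjectiveSpace R n m) i) := by
  obtain ⟨q, rfl⟩ := Nat.exists_eq_add_one_of_ne_zero hi.ne'
  exact RationalDegree.isZero_cech_homology _ _ q fun c hc =>
    RationalDegree.exists_cech_primitive R n hin c hc
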